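/- Let $\mathbb O$ denote the octonions with their Euclidean norm, and $\mathbb O^2\cong\mathbb R^{16}$. An octonionic (right) line is a real subspace of $\mathbb O^2$ of the form $\{(x,ax):x\in\mathbb O\}$ with $a\in\mathbb O$, or $\{(0,x):x\in\mathbb O\}$; an affine octonionic line is a translate of one. For an open set $\Omega\subset\mathbb O^2$, a function $u:\Omega\to[-\infty,\infty)$ is octonionic plurisubharmonic, $u\in OPSH(\Omega)$, if it is upper semicontinuous and its restriction to every affine octonionic line is subharmonic. For $E\subset\Omega$ put $$\omega(x,E,\Omega)=\sup\{u(x): u\in OPSH(\Omega),\ u\le 0 \text{ on } \Omega,\ u\le -1 \text{ on } E\},\qquad x\in\Omega,$$ and let the relative extremal function $\omega^*(\cdot,E,\Omega)$ be its upper semicontinuous regularization, $\omega^*(x,E,\Omega)=\limsup_{\Omega\ni y\to x}\omega(y,E,\Omega)$. A domain (nonempty connected open set) $\Omega\subset\mathbb O^2$ is octonionic hyperconvex if there is a continuous real-valued $\varrho\in OPSH(\Omega)$ with $\varrho<0$ in $\Omega$, $\lim_{x\to\partial\Omega}\varrho(x)=0$, and $\{x\in\Omega:\varrho(x)<c\}$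 relatively compact in $\Omega$ for every $c<0$. **Proposition.** (1) Let $\Omega\subset\mathbb O^2$ be an octonionic hyperconvex domain, and let $K\subset\Omega$ be a compact set which is the union of a family of closed balls of positive radii. Then $\omega^*(\cdot,K,\Omega)$ is a continuous real-valued function on $\Omega$, and $\omega^*(x,K,\Omega)=-1$ for all $x\in K$. (2) For $a\in\mathbb O^2$ and $0<r<R$, let $\overline B(a,r)$ and $B(a,R)$ be the closed and the open Euclidean ball with centre $a$. Then for all $x\in B(a,R)$, $$\omega(x,\overline B(a,r),B(a,R))=\omega^*(x,\overline B(a,r),B(a,R))=\max\left\{\frac{-|x-a|^{-6}+R^{-6}}{r^{-6}-R^{-6}},\,-1\right\},$$ where the right-hand side is read as $-1$ at $x=a$. -/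

import Mathlib

open Set Filter Topology Metric InnerProductSpace

/-- The octonions `𝕆 = ℍ ⊕ ℍ` as an eight-dimensional Euclidean space: the `L²` product norm is the
octonionic absolute value. -/
abbrev Octonion : Type := WithLp 2 (Quaternion ℝ × Quaternion ℝ)

/-- Octonionic multiplication `(a, b)(c, d) = (ac - d̄ b, da + b c̄)`. -/
noncomputable def Octonion.mul (x y : Octonion) : Octonion :=
  WithLp.toLp 2 (x.fst * y.fst - star y.snd * x.snd, y.snd * x.fst + x.snd * star y.fst)

/-- The space `𝕆²`, with its Euclidean structure as `ℝ¹⁶`. -/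
abbrev Octonion2 : Type := WithLp 2 (Octonion × Octonion)

/-- An octonionic (right) line: a real subspace of the form `{(x, a x)}` for some octonion `a`, or
the subspace `{(0, x)}`. -/
def IsOctonionicLine (L : Submodule ℝ Octonion2) : Prop :=
  (∃ a : Octonion,
      (L : Set Octonion2) = range fun x : Octonion => WithLp.toLp 2 (x, Octonion.mul a x)) ∨
    (L : Set Octonion2) = range fun x : Octonion => WithLp.toLp 2 ((0 : Octonion), x)

/-- Subharmonicity of `u : U → [-∞, ∞)`, on a subset `U` of a Euclidean space (`U` is open in all
uses): upper semicontinuity, and domination on every relatively compact open subset `G` of `U` by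
every harmonic function on `G`, continuous up to the boundary, which dominates `u` on the boundary.
As usual in potential theory, the function `-∞` is allowed. -/
structure IsSubharmonicOn {E : Type*} [NormedAddCommGroup E] [InnerProductSpace ℝ E]
    [FiniteDimensional ℝ E] (u : E → EReal) (U : Set E) : Prop where
  upperSemicontinuousOn : UpperSemicontinuousOn u U
  lt_top : ∀ x ∈ U, u x < ⊤
  le_of_harmonic : ∀ (G : Set E) (h : E → ℝ), IsOpen G → IsCompact (closure G) → closure G ⊆ U →
    ContinuousOn h (closure G) → HarmonicOnNhd h G →
    (∀ x ∈ frontier G, u x ≤ (h x : EReal)) → ∀ x ∈ G, u x ≤ (h x : EReal)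

/-- Octonionic plurisubharmonic functions `u : Ω → [-∞, ∞)` on an open set `Ω ⊆ 𝕆²`: `u` is upper
semicontinuous and its restriction to `(p + L) ∩ Ω` is subharmonic for every affine octonionic line
`p + L`. The line carries the Euclidean structure induced from `𝕆²`. Values of `u` outside `Ω` are
irrelevant. -/
structure IsOPSH (u : Octonion2 → EReal) (Ω : Set Octonion2) : Prop where
  upperSemicontinuousOn : UpperSemicontinuousOn u Ω
  lt_top : ∀ x ∈ Ω, u x < ⊤
  subharmonic_line : ∀ L : Submodule ℝ Octonion2, IsOctonionicLine L → ∀ p : Octonion2,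
    IsSubharmonicOn (fun t : L => u (p + (t : Octonion2))) {t : L | p + (t : Octonion2) ∈ Ω}

/-- The class `𝒰(E, Ω)` of nonpositive octonionic plurisubharmonic functions on `Ω` that are `≤ -1`
on `E`. -/
def extremalClass (E Ω : Set Octonion2) : Set (Octonion2 → EReal) :=
  {u | IsOPSH u Ω ∧ (∀ x ∈ Ω, u x ≤ 0) ∧ ∀ x ∈ E, u x ≤ -1}

/-- The upper envelope `ω(x, E, Ω)` of `𝒰(E, Ω)`; it is meaningful for `x ∈ Ω`. -/
noncomputable def extremalEnvelope (E Ω : Set Octonion2) (x : Octonion2) : EReal :=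
  ⨆ u ∈ extremalClass E Ω, u x

/-- The relative extremal function `ω*(·, E, Ω)`: the upper semicontinuous regularization on `Ω` of
`ω(·, E, Ω)`. -/
noncomputable def relativeExtremal (E Ω : Set Octonion2) (x : Octonion2) : EReal :=
  limsup (extremalEnvelope E Ω) (𝓝[Ω] x)

/-- An octonionic hyperconvex domain: a nonempty connected open set with a continuous negative
octonionic plurisubharmonic exhaustion `ϱ` tending to `0` at the boundary. -/
def IsOctonionicHyperconvex (Ω : Set Octonion2) : Prop :=
  IsOpen Ω ∧ IsConnected Ω ∧ ∃ ϱ : Octonion2 → ℝ,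
    ContinuousOn ϱ Ω ∧ IsOPSH (fun x => (ϱ x : EReal)) Ω ∧ (∀ x ∈ Ω, ϱ x < 0) ∧
    (∀ z ∈ frontier Ω, Tendsto ϱ (𝓝[Ω] z) (𝓝 0)) ∧
    ∀ c < 0, IsCompact (closure {x ∈ Ω | ϱ x < c}) ∧ closure {x ∈ Ω | ϱ x < c} ⊆ Ω

open Classical in
/-- The function `max {(-|x - a|⁻⁶ + R⁻⁶) / (r⁻⁶ - R⁻⁶), -1}`. At the centre `x = a` the first entry
is `-∞`, so that the maximum is `-1`. -/
noncomputable def concentricExtremal (a : Octonion2) (r R : ℝ) (x : Octonion2) : ℝ :=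
  if x = a then -1
  else max ((-(1 / ‖x - a‖ ^ 6) + 1 / R ^ 6) / (1 / r ^ 6 - 1 / R ^ 6)) (-1)

/-! ### Second derivatives, the kernel on 8-dimensional slices, and a criterion for subharmonicity.
-/

section SecondDerivatives

open scoped Laplacian

variable {E F : Type*} [NormedAddCommGroup E] [InnerProductSpace ℝ E]
  [NormedAddCommGroup F] [InnerProductSpace ℝ F]

/-! Concentric balls: `-|x|⁻⁶` is harmonic in dimension 8 away from the origin, and on any affine
8-dimensional slice its Laplacian is a nonnegative multiple of the squared distance from the origin
to the slice. Hence the explicit function is itself a competitor (`isOPSH_concentricExtremal`).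
Conversely, each point lies on an octonionic line through the centre
(`exists_isOctonionicLine_mem`); there the kernel is harmonic, so it dominates every competitor on
the annulus (`IsOPSH.le_concentricExtremal`).

Hyperconvex domains: a Walsh-type translation argument. For small `y`, the function `u(x + y) - ε`
built from a competitor `u` is glued with a multiple `Mϱ` of the exhaustion that is at most `-1` on
`K`. Near the boundary `Mϱ > -ε` wins, so the glued function lives on all of `Ω` (`IsOPSH.glue`). It
is at most `-1` on `K` as soon as the envelope is at most `-1 + ε` near `K`, which follows by
comparing with concentric balls around each ball of `K` (`eventually_extremalEnvelope_le`). Thus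
`ω(x + y) ≤ ω(x) + ε` uniformly (`extremalEnvelope_add_le`), so `ω` is continuous and regularization
changes nothing; `ω = -1` on `K` by definition. -/

theorem deriv_deriv_comp_line {f : E → ℝ} {x : E} (hf : ContDiffAt ℝ 2 f x) (e : E) :
    deriv (deriv fun s : ℝ => f (x + s • e)) 0 = iteratedFDeriv ℝ 2 f x ![e, e] := by
  have hline : ∀ s : ℝ, HasDerivAt (fun s : ℝ => x + s • e) e s := fun s => by
    simpa using ((hasDerivAt_id s).smul_const e).const_add x
  have htend : Tendsto (fun s : ℝ => x + s • e) (𝓝 0) (𝓝 x) := by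
    simpa using (hline 0).continuousAt.tendsto
  have hdiff : ∀ᶠ z in 𝓝 x, DifferentiableAt ℝ f z :=
    (hf.eventually (by simp)).mono fun z hz => hz.differentiableAt (by simp)
  have h1 : deriv (fun s : ℝ => f (x + s • e)) =ᶠ[𝓝 0] fun s => fderiv ℝ f (x + s • e) e := by
    filter_upwards [htend.eventually hdiff] with s hs
    exact (hs.hasFDerivAt.comp_hasDerivAt s (hline s)).deriv
  have h2 : DifferentiableAt ℝ (fderiv ℝ f) x :=
    (hf.fderiv_right (m := 1) (by norm_num)).differentiableAt (by simp)
  have h3 : HasDerivAt (fun s : ℝ => fderiv ℝ f (x + s • e)) (fderiv ℝ (fderiv ℝ f) x e) 0 := by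
    have h4 : HasFDerivAt (fderiv ℝ f) (fderiv ℝ (fderiv ℝ f) x) (x + (0 : ℝ) • e) := by
      simpa using h2.hasFDerivAt
    exact h4.comp_hasDerivAt 0 (hline 0)
  rw [h1.deriv_eq, iteratedFDeriv_two_apply]
  simpa using (h3.clm_apply (hasDerivAt_const (0 : ℝ) e)).deriv

/-- A positive second derivative would make the point a local minimum as well, so `g` would be
locally constant. -/
theorem deriv_deriv_nonpos_of_isLocalMax {g : ℝ → ℝ} {x : ℝ} (hg : IsLocalMax g x)
    (hc : ContinuousAt g x) : deriv (deriv g) x ≤ 0 := by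
  by_contra! h
  have hmin := isLocalMin_of_deriv_deriv_pos h hg.deriv_eq_zero hc
  have hconst : g =ᶠ[𝓝 x] fun _ => g x := by
    filter_upwards [hg, hmin] with z h1 h2 using le_antisymm h1 h2
  have h0 : deriv g =ᶠ[𝓝 x] fun _ => 0 := by
    simpa using hconst.deriv
  rw [h0.deriv_eq] at h
  simp at h

theorem laplacian_nonpos_of_isLocalMax [FiniteDimensional ℝ E] {g : E → ℝ} {x : E}
    (hg : IsLocalMax g x) (hc : ContDiffAt ℝ 2 g x) : Δ g x ≤ 0 := by
  rw [laplacian_eq_iteratedFDeriv_stdOrthonormalBasis]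
  refine Finset.sum_nonpos fun i _ => ?_
  set e := stdOrthonormalBasis ℝ E i
  rw [← deriv_deriv_comp_line hc]
  have hl : ContinuousAt (fun s : ℝ => x + s • e) 0 := by fun_prop
  have hx : x + (0 : ℝ) • e = x := by simp
  refine deriv_deriv_nonpos_of_isLocalMax ?_ ?_
  · have : Tendsto (fun s : ℝ => x + s • e) (𝓝 0) (𝓝 x) := by simpa using hl.tendsto
    have := this.eventually hg
    simpa [IsLocalMax, IsMaxFilter] using this
  · exact ContinuousAt.comp (f := fun s : ℝ => x + s • e) (g := g)
      (by simpa using hc.continuousAt) hl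

theorem contDiffAt_radial {φ : ℝ → ℝ} (q : F) (j : E →ₗᵢ[ℝ] F) {t : E}
    (hφ : ContDiffAt ℝ 2 φ (‖q + j t‖ ^ 2)) :
    ContDiffAt ℝ 2 (fun t => φ (‖q + j t‖ ^ 2)) t := by
  have : ContDiffAt ℝ 2 (fun t => ‖q + j t‖ ^ 2) t :=
    ((contDiff_const.add j.contDiff).norm_sq ℝ).contDiffAt
  exact ContDiffAt.comp t hφ this

/-- The map `t ↦ q + j t` parametrizes an affine slice of `F`. Using the squared norm as variable
makes the argument of `φ` a quadratic polynomial `A + 2Bs + s²` along each basis direction; `ψ` and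
`χ` play the roles of `φ'` and `φ''`. -/
theorem laplacian_radial [FiniteDimensional ℝ E] {φ ψ : ℝ → ℝ} {χ : ℝ} (q : F) (j : E →ₗᵢ[ℝ] F)
    {t : E} (hc : ContDiffAt ℝ 2 φ (‖q + j t‖ ^ 2))
    (hφ : ∀ᶠ s in 𝓝 (‖q + j t‖ ^ 2), HasDerivAt φ (ψ s) s)
    (hψ : HasDerivAt ψ χ (‖q + j t‖ ^ 2)) :
    Δ (fun t => φ (‖q + j t‖ ^ 2)) t =
      4 * χ * ∑ i, inner ℝ (q + j t) (j (stdOrthonormalBasis ℝ E i)) ^ 2 +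
        2 * Module.finrank ℝ E * ψ (‖q + j t‖ ^ 2) := by
  rw [laplacian_eq_iteratedFDeriv_stdOrthonormalBasis]
  have key : ∀ i, iteratedFDeriv ℝ 2 (fun t => φ (‖q + j t‖ ^ 2)) t
      ![stdOrthonormalBasis ℝ E i, stdOrthonormalBasis ℝ E i] =
      4 * χ * inner ℝ (q + j t) (j (stdOrthonormalBasis ℝ E i)) ^ 2 +
        2 * ψ (‖q + j t‖ ^ 2) := by
    intro i
    set e := stdOrthonormalBasis ℝ E i
    have he : ‖e‖ = 1 := (stdOrthonormalBasis ℝ E).orthonormal.1 i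
    rw [← deriv_deriv_comp_line (contDiffAt_radial q j hc)]
    set A := ‖q + j t‖ ^ 2 with hA
    set B := inner ℝ (q + j t) (j e) with hB
    have hN : ∀ s : ℝ, ‖q + j (t + s • e)‖ ^ 2 = A + 2 * B * s + s ^ 2 := by
      intro s
      rw [map_add, map_smul, ← add_assoc, norm_add_sq_real, inner_smul_right, norm_smul,
        j.norm_map, he, mul_pow, Real.norm_eq_abs, sq_abs]
      ring
    simp only [hN]
    have hp : ∀ s : ℝ, HasDerivAt (fun s : ℝ => A + 2 * B * s + s ^ 2) (2 * B + 2 * s) s := by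
      intro s
      have h1 : HasDerivAt (fun s : ℝ => A + 2 * B * s) (2 * B) s := by
        simpa using ((hasDerivAt_id s).const_mul (2 * B)).const_add A
      refine (h1.add (hasDerivAt_pow 2 s)).congr_deriv ?_
      simp
    have ht : Tendsto (fun s : ℝ => A + 2 * B * s + s ^ 2) (𝓝 0) (𝓝 A) := by
      simpa using (hp 0).continuousAt.tendsto
    have h1 : deriv (fun s : ℝ => φ (A + 2 * B * s + s ^ 2)) =ᶠ[𝓝 0]
        fun s => ψ (A + 2 * B * s + s ^ 2) * (2 * B + 2 * s) := by
      filter_upwards [ht.eventually hφ] with s hs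
      exact (hs.comp s (hp s)).deriv
    rw [h1.deriv_eq]
    have h2 : HasDerivAt ψ χ (A + 2 * B * 0 + 0 ^ 2) := by simpa using hψ
    have h3 : HasDerivAt (fun s : ℝ => 2 * B + 2 * s) 2 0 := by
      simpa using ((hasDerivAt_id (0 : ℝ)).const_mul 2).const_add (2 * B)
    have h4 := ((h2.comp 0 (hp 0)).mul h3).deriv
    simp only [Function.comp_def] at h4
    refine Eq.trans ?_ (h4.trans ?_)
    · rfl
    · simp; ring
  beta_reduce
  rw [Finset.sum_congr rfl fun i _ => key i, Finset.sum_add_distrib, Finset.mul_sum]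
  simp
  ring

theorem laplacian_norm_sq [FiniteDimensional ℝ E] (x : E) :
    Δ (fun x : E => ‖x‖ ^ 2) x = 2 * Module.finrank ℝ E := by
  have := laplacian_radial (φ := fun s => s) (ψ := fun _ => 1) (χ := 0) (0 : E)
    (LinearIsometry.id (R := ℝ) (E := E)) (t := x) contDiffAt_id
    (Eventually.of_forall fun s => hasDerivAt_id s) (hasDerivAt_const _ _)
  simpa using this

theorem contDiffAt_neg_inv_norm_pow_six (q : F) (j : E →ₗᵢ[ℝ] F) {t : E} (ht : q + j t ≠ 0) :
    ContDiffAt ℝ 2 (fun t => -(1 / ‖q + j t‖ ^ 6)) t := by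
  have hs : ‖q + j t‖ ^ 2 ≠ 0 := by simpa using ht
  have h := contDiffAt_radial (φ := fun s => -(1 / s ^ 3)) q j (t := t)
    ((contDiffAt_const.div (contDiffAt_id.pow 3) (by simpa using ht)).neg)
  simpa only [← pow_mul] using h

/-- Here `φ = -s⁻³`, so `4φ'' = -48 s⁻⁵` and, in dimension 8, `16φ' = 48 s⁻⁴`. The matching
constants leave the squared distance from the origin to the slice; Bessel and Parseval then give the
next two results. -/
theorem laplacian_neg_inv_norm_pow_six [FiniteDimensional ℝ E] (hE : Module.finrank ℝ E = 8)
    (q : F) (j : E →ₗᵢ[ℝ] F) {t : E} (ht : q + j t ≠ 0) :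
    Δ (fun t : E => (-(1 / ‖q + j t‖ ^ 6) : ℝ)) t = (48 / (‖q + j t‖ ^ 2) ^ 5 : ℝ) *
      (‖q + j t‖ ^ 2 - ∑ i, inner ℝ (q + j t) (j (stdOrthonormalBasis ℝ E i)) ^ 2) := by
  have hs : ‖q + j t‖ ^ 2 ≠ 0 := by simpa using ht
  have hφ : ∀ s : ℝ, s ≠ 0 → HasDerivAt (fun s : ℝ => -(1 / s ^ 3)) (3 / s ^ 4) s := by
    intro s hs
    have := ((hasDerivAt_pow 3 s).inv (pow_ne_zero 3 hs)).neg
    simp only [one_div]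
    refine this.congr_deriv ?_
    push_cast
    field_simp
  have hψ : ∀ s : ℝ, s ≠ 0 → HasDerivAt (fun s : ℝ => 3 / s ^ 4) (-12 / s ^ 5) s := by
    intro s hs
    have := ((hasDerivAt_pow 4 s).inv (pow_ne_zero 4 hs)).const_mul 3
    simp only [div_eq_mul_inv]
    refine this.congr_deriv ?_
    push_cast
    field_simp
    norm_num
  have h := laplacian_radial (φ := fun s => -(1 / s ^ 3)) q j (t := t)
    ((contDiffAt_const.div (contDiffAt_id.pow 3) (by simpa using ht)).neg)
    ((eventually_ne_nhds hs).mono hφ) (hψ _ hs)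
  have e : (fun t : E => -(1 / (‖q + j t‖ ^ 2) ^ 3)) = fun t : E => -(1 / ‖q + j t‖ ^ 6) := by
    simp only [← pow_mul]
  rw [← e, h]
  generalize (∑ i, inner ℝ (q + j t) (j (stdOrthonormalBasis ℝ E i)) ^ 2) = S
  rw [hE]
  push_cast
  field_simp
  ring

theorem laplacian_neg_inv_norm_pow_six_nonneg [FiniteDimensional ℝ E]
    (hE : Module.finrank ℝ E = 8) (q : F) (j : E →ₗᵢ[ℝ] F) {t : E} (ht : q + j t ≠ 0) :
    0 ≤ Δ (fun t : E => (-(1 / ‖q + j t‖ ^ 6) : ℝ)) t := by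
  rw [laplacian_neg_inv_norm_pow_six hE q j ht]
  refine mul_nonneg (by positivity) (sub_nonneg.2 ?_)
  have := ((stdOrthonormalBasis ℝ E).orthonormal.comp_linearIsometry j).sum_inner_products_le
    (q + j t) (s := Finset.univ)
  simpa [real_inner_comm] using this

theorem harmonicAt_neg_inv_norm_pow_six [FiniteDimensional ℝ E]
    (hE : Module.finrank ℝ E = 8) {t : E} (ht : t ≠ 0) :
    HarmonicAt (fun t : E => -(1 / ‖t‖ ^ 6)) t := by
  have hc := contDiffAt_neg_inv_norm_pow_six (0 : E) (LinearIsometry.id (R := ℝ) (E := E))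
    (t := t) (by simpa using ht)
  refine ⟨by simpa using hc, ?_⟩
  filter_upwards [eventually_ne_nhds ht] with x hx
  have := laplacian_neg_inv_norm_pow_six hE (0 : E)
    (LinearIsometry.id (R := ℝ) (E := E)) (t := x) (by simpa using hx)
  have h2 := (stdOrthonormalBasis ℝ E).sum_sq_norm_inner_left x
  simp only [Real.norm_eq_abs, sq_abs] at h2
  simpa [h2] using this

/-- A continuous function that is touched from below at every point by a twice continuously
differentiable function with nonnegative Laplacian there is subharmonic. -/
theorem isSubharmonicOn_of_touching [FiniteDimensional ℝ E] [Nontrivial E] {v : E → ℝ} {U : Set E}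
    (hv : ContinuousOn v U)
    (ht : ∀ y ∈ U, ∃ f : E → ℝ, ContDiffAt ℝ 2 f y ∧ 0 ≤ Δ f y ∧ f y = v y ∧
      ∀ᶠ z in 𝓝 y, f z ≤ v z) :
    IsSubharmonicOn (fun x => (v x : EReal)) U where
  upperSemicontinuousOn :=
    (continuous_coe_real_ereal.comp_continuousOn hv).upperSemicontinuousOn
  lt_top x _ := EReal.coe_lt_top _
  le_of_harmonic := by
    intro G h hG hGc hGU hhc hh hle x₀ hx₀
    simp only [EReal.coe_le_coe_iff] at hle ⊢
    by_contra! hlt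
    obtain ⟨C, hC⟩ := hGc.isBounded.exists_norm_le
    have hC0 : 0 ≤ C := (norm_nonneg _).trans (hC x₀ (subset_closure hx₀))
    -- The penalty `ε‖x‖²` makes the Laplacian of the test function strictly positive, while `ε` is
    -- small enough that the maximum of `w` stays off the frontier.
    obtain ⟨ε, hε, hεC⟩ : ∃ ε : ℝ, 0 < ε ∧ ε * C ^ 2 < v x₀ - h x₀ := by
      refine ⟨(v x₀ - h x₀) / (C ^ 2 + 1), by apply div_pos <;> [linarith; positivity], ?_⟩
      rw [div_mul_eq_mul_div, div_lt_iff₀ (by positivity)]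
      nlinarith
    set w : E → ℝ := fun x => v x - h x + ε * ‖x‖ ^ 2 with hw
    have hwc : ContinuousOn w (closure G) :=
      ((hv.mono hGU).sub hhc).add (by fun_prop)
    obtain ⟨y, hy, hmax⟩ := hGc.exists_isMaxOn ⟨x₀, subset_closure hx₀⟩ hwc
    have hwx : v x₀ - h x₀ ≤ w y := by
      have h1 : w x₀ ≤ w y := hmax (subset_closure hx₀)
      have h2 : 0 ≤ ε * ‖x₀‖ ^ 2 := by positivity
      simp only [hw] at h1 ⊢
      linarith
    have hyG : y ∈ G := by
      by_contra hyG
      have h1 := hle y ⟨hy, fun hi => hyG (interior_subset hi)⟩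
      have h2 : ‖y‖ ^ 2 ≤ C ^ 2 := pow_le_pow_left₀ (norm_nonneg _) (hC y hy) 2
      have h3 := mul_le_mul_of_nonneg_left h2 hε.le
      simp only [hw] at hwx
      linarith
    obtain ⟨f, hf, hΔ, hfy, hfv⟩ := ht y (hGU hy)
    have hn : ContDiffAt ℝ 2 (fun x : E => ‖x‖ ^ 2) y := (contDiff_norm_sq ℝ).contDiffAt
    have hcd : ContDiffAt ℝ 2 (f - h + ε • fun x : E => ‖x‖ ^ 2) y :=
      (hf.sub (hh y hyG).1).add (hn.const_smul ε)
    have hloc : IsLocalMax (f - h + ε • fun x : E => ‖x‖ ^ 2) y := by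
      filter_upwards [hfv, hG.mem_nhds hyG] with z hz hzG
      have h1 : w z ≤ w y := hmax (subset_closure hzG)
      simp only [hw] at h1
      simp only [Pi.add_apply, Pi.sub_apply, Pi.smul_apply, smul_eq_mul]
      linarith
    have hle0 := laplacian_nonpos_of_isLocalMax hloc hcd
    have hadd := ContDiffAt.laplacian_add (f₁ := f - h) (f₂ := ε • fun x : E => ‖x‖ ^ 2)
      (hf.sub (hh y hyG).1) (hn.const_smul ε)
    rw [hadd, hf.laplacian_sub (hh y hyG).1, laplacian_smul ε hn, laplacian_norm_sq,
      (hh y hyG).2.eq_of_nhds] at hle0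
    have hpos : (0 : ℝ) < Module.finrank ℝ E := by exact_mod_cast Module.finrank_pos
    have : 0 < ε * (2 * Module.finrank ℝ E) := by positivity
    simp only [Pi.zero_apply, smul_eq_mul] at hle0
    linarith

end SecondDerivatives

/-! ### Octonionic lines: dimension, and existence through every point. -/

section OctonionicLines

theorem withLp_two_prod_ext {α β : Type*} {x y : WithLp 2 (α × β)} (h₁ : x.fst = y.fst)
    (h₂ : x.snd = y.snd) : x = y :=
  WithLp.ofLp_injective 2 (Prod.ext h₁ h₂)

/-- The map `x ↦ (x, a x)`, whose range is the octonionic line of slope `a`. -/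
noncomputable def Octonion.graphMap (a : Octonion) : Octonion →ₗ[ℝ] Octonion2 where
  toFun x := WithLp.toLp 2 (x, Octonion.mul a x)
  map_add' x y := by
    refine withLp_two_prod_ext rfl ?_
    refine withLp_two_prod_ext ?_ ?_
    · simp [Octonion.mul]
      noncomm_ring
    · simp [Octonion.mul]
      noncomm_ring
  map_smul' c x := by
    refine withLp_two_prod_ext rfl ?_
    refine withLp_two_prod_ext ?_ ?_
    · simp [Octonion.mul, smul_sub]
    · simp [Octonion.mul]

/-- The map `x ↦ (0, x)`, whose range is the vertical octonionic line. -/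
noncomputable def Octonion.verticalMap : Octonion →ₗ[ℝ] Octonion2 where
  toFun x := WithLp.toLp 2 ((0 : Octonion), x)
  map_add' x y := by
    exact withLp_two_prod_ext (by simp) rfl
  map_smul' c x := by
    exact withLp_two_prod_ext (by simp) rfl

theorem Octonion.graphMap_injective (a : Octonion) : Function.Injective (Octonion.graphMap a) :=
  fun _ _ h => congrArg (fun z : Octonion2 => z.fst) h

theorem Octonion.verticalMap_injective : Function.Injective Octonion.verticalMap :=
  fun _ _ h => congrArg (fun z : Octonion2 => z.snd) h

theorem isOctonionicLine_range_graphMap (a : Octonion) :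
    IsOctonionicLine (LinearMap.range (Octonion.graphMap a)) :=
  Or.inl ⟨a, rfl⟩

theorem isOctonionicLine_range_verticalMap :
    IsOctonionicLine (LinearMap.range Octonion.verticalMap) :=
  Or.inr rfl

theorem Octonion.finrank_eq : Module.finrank ℝ Octonion = 8 := by
  rw [(WithLp.linearEquiv 2 ℝ (Quaternion ℝ × Quaternion ℝ)).finrank_eq, Module.finrank_prod,
    Quaternion.finrank_eq_four]

theorem IsOctonionicLine.finrank_eq {L : Submodule ℝ Octonion2} (hL : IsOctonionicLine L) :
    Module.finrank ℝ L = 8 := by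
  rw [← Octonion.finrank_eq]
  rcases hL with ⟨a, ha⟩ | h
  · rw [show L = LinearMap.range (Octonion.graphMap a) from SetLike.coe_injective ha]
    exact LinearMap.finrank_range_of_inj (Octonion.graphMap_injective a)
  · rw [show L = LinearMap.range Octonion.verticalMap from SetLike.coe_injective h]
    exact LinearMap.finrank_range_of_inj Octonion.verticalMap_injective

/-- The product `y x̄` satisfies `(y x̄) x = |x|² y`. -/
theorem Octonion.mul_conj_mul (x y : Octonion) :
    Octonion.mul (Octonion.mul y (WithLp.toLp 2 (star x.fst, -x.snd))) x =
      (Quaternion.normSq x.fst + Quaternion.normSq x.snd) • y := by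
  refine withLp_two_prod_ext ?_ ?_ <;> ext <;>
    simp [Octonion.mul, Quaternion.normSq_def'] <;> ring

theorem Octonion.smul_mul (c : ℝ) (x y : Octonion) :
    Octonion.mul (c • x) y = c • Octonion.mul x y := by
  refine withLp_two_prod_ext ?_ ?_ <;> simp [Octonion.mul, smul_sub]

/-- For `z = (x, y)` with `x ≠ 0` the slope is `y x̄ / |x|²`, which works although multiplication is
not associative, because `(y x̄) x = |x|² y`. -/
theorem exists_isOctonionicLine_mem (z : Octonion2) :
    ∃ L : Submodule ℝ Octonion2, IsOctonionicLine L ∧ z ∈ L := by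
  by_cases hz : z.fst = 0
  · refine ⟨_, isOctonionicLine_range_verticalMap, z.snd, ?_⟩
    exact withLp_two_prod_ext hz.symm rfl
  · set x := z.fst
    set N := Quaternion.normSq x.fst + Quaternion.normSq x.snd with hN
    have hN0 : N ≠ 0 := by
      intro h
      have h1 : Quaternion.normSq x.fst = 0 := by
        linarith [Quaternion.normSq_nonneg (a := x.fst), Quaternion.normSq_nonneg (a := x.snd)]
      have h2 : Quaternion.normSq x.snd = 0 := by linarith
      refine hz ?_
      exact withLp_two_prod_ext (Quaternion.normSq_eq_zero.1 h1) (Quaternion.normSq_eq_zero.1 h2)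
    refine ⟨_, isOctonionicLine_range_graphMap
      (N⁻¹ • Octonion.mul z.snd (WithLp.toLp 2 (star x.fst, -x.snd))), x, ?_⟩
    refine withLp_two_prod_ext rfl ?_
    change Octonion.mul _ x = z.snd
    rw [Octonion.smul_mul, Octonion.mul_conj_mul, smul_smul, inv_mul_cancel₀ hN0, one_smul]

end OctonionicLines

/-! ### The extremal function of concentric balls. -/

section ConcentricBalls

open scoped Laplacian

variable {a : Octonion2} {r R : ℝ}

theorem one_div_pow_six_sub_pos (hr : 0 < r) (hR : r < R) : 0 < 1 / r ^ 6 - 1 / R ^ 6 :=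
  sub_pos.2 (one_div_lt_one_div_of_lt (by positivity) (pow_lt_pow_left₀ hR hr.le (by norm_num)))

theorem neg_one_le_div_iff {s : ℝ} (hr : 0 < r) (hR : r < R) (hs : 0 < s) :
    -1 ≤ (-(1 / s ^ 6) + 1 / R ^ 6) / (1 / r ^ 6 - 1 / R ^ 6) ↔ r ≤ s := by
  rw [le_div_iff₀ (one_div_pow_six_sub_pos hr hR), ← pow_le_pow_iff_left₀ hr.le hs.le
    (by norm_num : (6 : ℕ) ≠ 0), ← one_div_le_one_div (pow_pos hs 6) (pow_pos hr 6)]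
  constructor <;> intro h <;> linarith

theorem concentricExtremal_of_le_norm (hr : 0 < r) (hR : r < R) {x : Octonion2}
    (hx : r ≤ ‖x - a‖) : concentricExtremal a r R x =
      (-(1 / ‖x - a‖ ^ 6) + 1 / R ^ 6) / (1 / r ^ 6 - 1 / R ^ 6) := by
  have h0 : 0 < ‖x - a‖ := hr.trans_le hx
  rw [concentricExtremal, if_neg (sub_ne_zero.1 (norm_pos_iff.1 h0)),
    max_eq_left ((neg_one_le_div_iff hr hR h0).2 hx)]

theorem concentricExtremal_of_norm_le (hr : 0 < r) (hR : r < R) {x : Octonion2}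
    (hx : ‖x - a‖ ≤ r) : concentricExtremal a r R x = -1 := by
  by_cases h : x = a
  · rw [concentricExtremal, if_pos h]
  rw [concentricExtremal, if_neg h]
  have h0 : 0 < ‖x - a‖ := norm_pos_iff.2 (sub_ne_zero.2 h)
  rcases hx.eq_or_lt with hx | hx
  · rw [hx, neg_add_eq_sub, ← neg_sub, neg_div, div_self (one_div_pow_six_sub_pos hr hR).ne',
      max_self]
  · exact max_eq_right (not_le.1 fun hle => hx.not_ge ((neg_one_le_div_iff hr hR h0).1 hle)).le

/-- Truncating the radius at `r` instead of the value at `-1` removes the singularity at the centre,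
so continuity and the sign can be read off. -/
theorem concentricExtremal_eq_max_norm (hr : 0 < r) (hR : r < R) (x : Octonion2) :
    concentricExtremal a r R x =
      (-(1 / (max ‖x - a‖ r) ^ 6) + 1 / R ^ 6) / (1 / r ^ 6 - 1 / R ^ 6) := by
  rcases le_total r ‖x - a‖ with h | h
  · rw [max_eq_left h, concentricExtremal_of_le_norm hr hR h]
  · rw [max_eq_right h, concentricExtremal_of_norm_le hr hR h, neg_add_eq_sub, ← neg_sub, neg_div,
      div_self (one_div_pow_six_sub_pos hr hR).ne']

theorem continuous_concentricExtremal (hr : 0 < r) (hR : r < R) :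
    Continuous (concentricExtremal a r R) := by
  rw [funext (concentricExtremal_eq_max_norm hr hR)]
  refine ((continuous_const.div (by fun_prop) fun x => ?_).neg.add
    continuous_const).div_const _
  have : 0 < max ‖x - a‖ r := lt_max_of_lt_right hr
  positivity

theorem neg_one_le_concentricExtremal (x : Octonion2) : -1 ≤ concentricExtremal a r R x := by
  unfold concentricExtremal
  split_ifs
  · exact le_rfl
  · exact le_max_right _ _

theorem concentricExtremal_nonpos (hr : 0 < r) (hR : r < R) {x : Octonion2}
    (hx : ‖x - a‖ ≤ R) : concentricExtremal a r R x ≤ 0 := by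
  rw [concentricExtremal_eq_max_norm hr hR]
  refine div_nonpos_of_nonpos_of_nonneg ?_ (one_div_pow_six_sub_pos hr hR).le
  have h0 : 0 < max ‖x - a‖ r := lt_max_of_lt_right hr
  have h1 : 1 / R ^ 6 ≤ 1 / (max ‖x - a‖ r) ^ 6 :=
    one_div_le_one_div_of_le (by positivity)
      (pow_le_pow_left₀ h0.le (max_le hx hR.le) 6)
  linarith

theorem contDiffAt_and_laplacian_nonneg_kernel {E F : Type*} [NormedAddCommGroup E]
    [InnerProductSpace ℝ E] [FiniteDimensional ℝ E] [NormedAddCommGroup F] [InnerProductSpace ℝ F]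
    (hE : Module.finrank ℝ E = 8) (q : F) (j : E →ₗᵢ[ℝ] F) {t : E} (ht : q + j t ≠ 0) (k : ℝ)
    {c : ℝ} (hc : 0 < c) :
    ContDiffAt ℝ 2 (fun t : E => (-(1 / ‖q + j t‖ ^ 6) + k) / c) t ∧
      0 ≤ Δ (fun t : E => ((-(1 / ‖q + j t‖ ^ 6) + k) / c : ℝ)) t := by
  have hd := contDiffAt_neg_inv_norm_pow_six q j ht
  have hΔ := laplacian_neg_inv_norm_pow_six_nonneg hE q j ht
  set f : E → ℝ := fun t => -(1 / ‖q + j t‖ ^ 6)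
  have e : (fun t : E => ((-(1 / ‖q + j t‖ ^ 6) + k) / c : ℝ)) = c⁻¹ • f + fun _ => c⁻¹ * k := by
    funext t
    simp only [Pi.add_apply, Pi.smul_apply, smul_eq_mul, f]
    ring
  rw [e]
  refine ⟨(hd.const_smul c⁻¹).add (contDiffAt_const (c := c⁻¹ * k)), ?_⟩
  have hadd := ContDiffAt.laplacian_add (f₁ := c⁻¹ • f) (f₂ := fun _ => c⁻¹ * k)
    (hd.const_smul c⁻¹) contDiffAt_const
  rw [hadd, laplacian_smul _ hd]
  simp only [laplacian_const, Pi.zero_apply, add_zero, smul_eq_mul]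
  positivity

theorem harmonicAt_kernel {E : Type*} [NormedAddCommGroup E]
    [InnerProductSpace ℝ E] [FiniteDimensional ℝ E] (hE : Module.finrank ℝ E = 8) {t : E}
    (ht : t ≠ 0) (k c : ℝ) : HarmonicAt (fun t : E => (-(1 / ‖t‖ ^ 6) + k) / c) t := by
  have e : (fun t : E => ((-(1 / ‖t‖ ^ 6) + k) / c : ℝ)) =
      (c⁻¹ • fun t : E => -(1 / ‖t‖ ^ 6)) + fun _ => c⁻¹ * k := by
    funext t
    simp only [Pi.add_apply, Pi.smul_apply, smul_eq_mul]
    ring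
  rw [e]
  exact ((harmonicAt_neg_inv_norm_pow_six hE ht).const_smul).add (harmonicAt_const _)

theorem IsSubharmonicOn.le_of_annulus {E : Type*} [NormedAddCommGroup E]
    [InnerProductSpace ℝ E] [FiniteDimensional ℝ E] (hE : Module.finrank ℝ E = 8) {u : E → EReal}
    {U : Set E} (hu : IsSubharmonicOn u U) (hr : 0 < r) (hR : r < R) (hU : closedBall 0 R ⊆ U)
    (h0 : ∀ t, ‖t‖ = R → u t ≤ 0) (h1 : ∀ t, ‖t‖ = r → u t ≤ -1) {t : E} (hrt : r < ‖t‖)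
    (htR : ‖t‖ < R) :
    u t ≤ (((-(1 / ‖t‖ ^ 6) + 1 / R ^ 6) / (1 / r ^ 6 - 1 / R ^ 6) : ℝ) : EReal) := by
  set G : Set E := {t | r < ‖t‖ ∧ ‖t‖ < R} with hG
  have hGo : IsOpen G :=
    (isOpen_lt continuous_const continuous_norm).inter (isOpen_lt continuous_norm continuous_const)
  have hGcl : closure G ⊆ {t | r ≤ ‖t‖ ∧ ‖t‖ ≤ R} :=
    closure_minimal (fun t ht => ⟨ht.1.le, ht.2.le⟩)
      ((isClosed_le continuous_const continuous_norm).inter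
        (isClosed_le continuous_norm continuous_const))
  have hGball : closure G ⊆ closedBall 0 R := fun t ht => by simpa using (hGcl ht).2
  have hGc : IsCompact (closure G) :=
    (isCompact_closedBall (0 : E) R).of_isClosed_subset isClosed_closure hGball
  have hharm : HarmonicOnNhd (fun t : E => (-(1 / ‖t‖ ^ 6) + 1 / R ^ 6) / (1 / r ^ 6 - 1 / R ^ 6))
      (closure G) := fun t ht =>
    harmonicAt_kernel hE (norm_pos_iff.1 (hr.trans_le (hGcl ht).1)) _ _
  refine hu.le_of_harmonic G _ hGo hGc (hGball.trans hU) hharm.continuousOn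
    (hharm.mono subset_closure) (fun t ht => ?_) t ⟨hrt, htR⟩
  have htc := hGcl ht.1
  have htn : ¬ (r < ‖t‖ ∧ ‖t‖ < R) := fun hi => ht.2 (hGo.interior_eq.symm ▸ hi)
  rcases htc.1.eq_or_lt with hrt | hrt
  · rw [← hrt, neg_add_eq_sub, ← neg_sub, neg_div,
      div_self (one_div_pow_six_sub_pos hr hR).ne']
    exact h1 t hrt.symm
  · have hRt : ‖t‖ = R := le_antisymm htc.2 (not_lt.1 fun hlt => htn ⟨hrt, hlt⟩)
    rw [hRt, neg_add_cancel, zero_div]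
    exact h0 t hRt

theorem isSubharmonicOn_const {E : Type*} [NormedAddCommGroup E] [InnerProductSpace ℝ E]
    [FiniteDimensional ℝ E] [Nontrivial E] (c : ℝ) (U : Set E) :
    IsSubharmonicOn (fun _ => (c : EReal)) U :=
  isSubharmonicOn_of_touching (v := fun _ => c) continuousOn_const fun _ _ =>
    ⟨fun _ => c, contDiffAt_const, by simp, rfl, Eventually.of_forall fun _ => le_rfl⟩

theorem IsOctonionicLine.nontrivial {L : Submodule ℝ Octonion2} (hL : IsOctonionicLine L) :
    Nontrivial L :=
  Module.nontrivial_of_finrank_pos (R := ℝ) (by rw [hL.finrank_eq]; norm_num)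

theorem isOPSH_const (c : ℝ) (Ω : Set Octonion2) : IsOPSH (fun _ => (c : EReal)) Ω where
  upperSemicontinuousOn := continuousOn_const.upperSemicontinuousOn
  lt_top _ _ := EReal.coe_lt_top _
  subharmonic_line _ hL _ :=
    have := hL.nontrivial
    isSubharmonicOn_const c _

theorem isSubharmonicOn_comp_of_eq_kernel {E F : Type*} [NormedAddCommGroup E]
    [InnerProductSpace ℝ E] [FiniteDimensional ℝ E] [Nontrivial E] [NormedAddCommGroup F]
    [InnerProductSpace ℝ F] (hE : Module.finrank ℝ E = 8) (j : E →ₗᵢ[ℝ] F) {V : F → ℝ} {a : F}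
    {k c : ℝ} (hr : 0 < r) (hc : 0 < c) (hV : Continuous V) (hge : ∀ x, -1 ≤ V x)
    (hin : ∀ x, ‖x - a‖ ≤ r → V x = -1)
    (hout : ∀ x, r ≤ ‖x - a‖ → V x = (-(1 / ‖x - a‖ ^ 6) + k) / c) (p : F) (U : Set E) :
    IsSubharmonicOn (fun t => (V (p + j t) : EReal)) U := by
  refine isSubharmonicOn_of_touching (v := fun t => V (p + j t))
    (hV.comp (continuous_const.add j.continuous)).continuousOn fun y _ => ?_
  -- In the closed ball, sphere included, the constant `-1` touches `V` from below; outside, the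
  -- kernel coincides with `V` locally.
  rcases le_or_gt ‖p + j y - a‖ r with hy | hy
  · exact ⟨fun _ => -1, contDiffAt_const, by simp, (hin _ hy).symm,
      Eventually.of_forall fun _ => hge _⟩
  have he : ∀ t, p - a + j t = p + j t - a := fun t => sub_add_eq_add_sub _ _ _
  have hy0 : p - a + j y ≠ 0 := by
    rw [he]
    exact norm_pos_iff.1 (hr.trans hy)
  obtain ⟨hcd, hΔ⟩ := contDiffAt_and_laplacian_nonneg_kernel hE (p - a) j hy0 k hc
  refine ⟨_, hcd, hΔ, ?_, ?_⟩
  · rw [he, hout _ hy.le]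
  · have hcont : Continuous (fun t => ‖p + j t - a‖) :=
      ((continuous_const.add j.continuous).sub continuous_const).norm
    filter_upwards [hcont.continuousAt.eventually (lt_mem_nhds hy)] with t ht
    rw [he, hout _ ht.le]

theorem isOPSH_concentricExtremal (hr : 0 < r) (hR : r < R) (Ω : Set Octonion2) :
    IsOPSH (fun x => (concentricExtremal a r R x : EReal)) Ω where
  upperSemicontinuousOn := (continuous_coe_real_ereal.comp
    (continuous_concentricExtremal hr hR)).continuousOn.upperSemicontinuousOn
  lt_top _ _ := EReal.coe_lt_top _
  subharmonic_line L hL p := by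
    have := hL.nontrivial
    exact isSubharmonicOn_comp_of_eq_kernel (E := L) (F := Octonion2) hL.finrank_eq L.subtypeₗᵢ hr
      (one_div_pow_six_sub_pos hr hR) (continuous_concentricExtremal hr hR)
      neg_one_le_concentricExtremal (fun _ => concentricExtremal_of_norm_le hr hR)
      (fun _ => concentricExtremal_of_le_norm hr hR) p _

/-- Restrict to the octonionic line through `a` and `x`: there the kernel is harmonic, with values
`-1` and `0` on the two bounding spheres. -/
theorem IsOPSH.le_of_annulus {u : Octonion2 → EReal} {Ω : Set Octonion2} (hu : IsOPSH u Ω)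
    (hr : 0 < r) (hR : r < R) (hΩ : closedBall a R ⊆ Ω) (h0 : ∀ x ∈ Ω, u x ≤ 0)
    (h1 : ∀ x ∈ closedBall a r, u x ≤ -1) {x : Octonion2} (hrx : r < ‖x - a‖)
    (hxR : ‖x - a‖ < R) :
    u x ≤ (concentricExtremal a r R x : EReal) := by
  obtain ⟨L, hL, hxL⟩ := exists_isOctonionicLine_mem (x - a)
  have hmem : ∀ (s : ℝ) (t : L), ‖t‖ ≤ s → a + (t : Octonion2) ∈ closedBall a s := fun s t ht => by
    rwa [mem_closedBall, dist_eq_norm, add_sub_cancel_left]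
  have key := (hu.subharmonic_line L hL a).le_of_annulus hL.finrank_eq hr hR
    (fun t ht => hΩ (hmem R t (mem_closedBall_zero_iff.1 ht)))
    (fun t ht => h0 _ (hΩ (hmem R t ht.le))) (fun t ht => h1 _ (hmem r t ht.le))
    (t := ⟨x - a, hxL⟩) hrx hxR
  rw [concentricExtremal_of_le_norm hr hR hrx.le]
  rwa [add_sub_cancel] at key

/-- The sphere of radius `R` need not lie in `Ω`, so the annulus estimate is applied with outer
radius `s < R`, and `s` tends to `R`. -/
theorem IsOPSH.le_concentricExtremal {u : Octonion2 → EReal} {Ω : Set Octonion2}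
    (hu : IsOPSH u Ω) (hr : 0 < r) (hR : r < R) (hΩ : ball a R ⊆ Ω) (h0 : ∀ x ∈ Ω, u x ≤ 0)
    (h1 : ∀ x ∈ closedBall a r, u x ≤ -1) {x : Octonion2} (hx : x ∈ ball a R) :
    u x ≤ (concentricExtremal a r R x : EReal) := by
  rw [mem_ball, dist_eq_norm] at hx
  rcases le_or_gt ‖x - a‖ r with hrx | hrx
  · rw [concentricExtremal_of_norm_le hr hR hrx]
    exact h1 x (by rwa [mem_closedBall, dist_eq_norm])
  have hlim : Tendsto (fun s : ℝ => (concentricExtremal a r s x : EReal)) (𝓝[<] R)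
      (𝓝 (concentricExtremal a r R x : EReal)) := by
    refine (continuous_coe_real_ereal.tendsto _).comp ?_
    have hc : ContinuousAt
        (fun s : ℝ => (-(1 / ‖x - a‖ ^ 6) + 1 / s ^ 6) / (1 / r ^ 6 - 1 / s ^ 6)) R := by
      have hR0 : R ^ 6 ≠ 0 := (pow_pos (hr.trans hR) 6).ne'
      have hd : ContinuousAt (fun s : ℝ => 1 / s ^ 6) R :=
        continuousAt_const.div (by fun_prop) hR0
      exact (continuousAt_const.add hd).div (continuousAt_const.sub hd)
        (one_div_pow_six_sub_pos hr hR).ne'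
    rw [concentricExtremal_of_le_norm hr hR hrx.le]
    refine (hc.tendsto.mono_left nhdsWithin_le_nhds).congr' ?_
    filter_upwards [Ioo_mem_nhdsLT hx] with s hs
    rw [concentricExtremal_of_le_norm hr (hrx.trans hs.1) hrx.le]
  refine ge_of_tendsto hlim ?_
  filter_upwards [Ioo_mem_nhdsLT hx] with s hs
  exact hu.le_of_annulus hr (hrx.trans hs.1) ((closedBall_subset_ball hs.2).trans hΩ) h0 h1 hrx hs.1

theorem extremalEnvelope_le_concentricExtremal {E Ω : Set Octonion2} (hr : 0 < r) (hR : r < R)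
    (hE : closedBall a r ⊆ E) (hΩ : ball a R ⊆ Ω) {x : Octonion2} (hx : x ∈ ball a R) :
    extremalEnvelope E Ω x ≤ (concentricExtremal a r R x : EReal) :=
  iSup₂_le fun _ hu => hu.1.le_concentricExtremal hr hR hΩ hu.2.1
    (fun y hy => hu.2.2 y (hE hy)) hx

theorem extremalEnvelope_closedBall_ball (hr : 0 < r) (hR : r < R) {x : Octonion2}
    (hx : x ∈ ball a R) :
    extremalEnvelope (closedBall a r) (ball a R) x = (concentricExtremal a r R x : EReal) := by
  refine le_antisymm (extremalEnvelope_le_concentricExtremal hr hR subset_rfl subset_rfl hx)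
    (le_iSup₂ (f := fun (u : Octonion2 → EReal)
      (_ : u ∈ extremalClass (closedBall a r) (ball a R)) => u x)
      (fun x => (concentricExtremal a r R x : EReal))
      ⟨isOPSH_concentricExtremal hr hR _, fun y hy => ?_, fun y hy => ?_⟩)
  · rw [mem_ball, dist_eq_norm] at hy
    beta_reduce
    exact_mod_cast concentricExtremal_nonpos hr hR hy.le
  · rw [mem_closedBall, dist_eq_norm] at hy
    beta_reduce
    rw [concentricExtremal_of_norm_le hr hR hy]
    norm_num

theorem relativeExtremal_eq_of_continuousOn {E Ω : Set Octonion2} {g : Octonion2 → ℝ}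
    (hg : ContinuousOn g Ω) (h : ∀ x ∈ Ω, extremalEnvelope E Ω x = (g x : EReal)) {x : Octonion2}
    (hx : x ∈ Ω) : relativeExtremal E Ω x = (g x : EReal) := by
  have : (𝓝[Ω] x).NeBot := mem_closure_iff_nhdsWithin_neBot.1 (subset_closure hx)
  refine Tendsto.limsup_eq (((continuous_coe_real_ereal.tendsto _).comp (hg x hx)).congr' ?_)
  filter_upwards [self_mem_nhdsWithin] with y hy using (h y hy).symm

end ConcentricBalls

/-! ### Gluing, scaling and translating plurisubharmonic functions. -/

section Gluing

open Classical in
-- Points with `g ≤ c` are interior to `U`; where `g > c ≥ u`, the glued function is just `g`, so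
-- leaving `U` causes no jump.
theorem upperSemicontinuousOn_glue {X : Type*} [TopologicalSpace X] {u : X → EReal} {g : X → ℝ}
    {U V : Set X} (hU : IsOpen U) (hV : IsOpen V) (hu : UpperSemicontinuousOn u U)
    (hg : ContinuousOn g V) {c : ℝ} (huc : ∀ x ∈ U, u x ≤ c) (hsub : ∀ x ∈ V, g x ≤ c → x ∈ U) :
    UpperSemicontinuousOn (fun x => if x ∈ U then max (u x) (g x) else (g x : EReal)) V := by
  intro x hx
  refine UpperSemicontinuousAt.upperSemicontinuousWithinAt V ?_
  have hgx : ContinuousAt g x := hg.continuousAt (hV.mem_nhds hx)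
  have hgx' : UpperSemicontinuousAt (fun z => (g z : EReal)) x :=
    ContinuousAt.upperSemicontinuousAt ((continuous_coe_real_ereal.tendsto _).comp hgx)
  rcases le_or_gt (g x) c with hc | hc
  · have hxU := hsub x hx hc
    intro b hb
    have hb : max (u x) (g x) < b := by simpa [hxU] using hb
    have hux : ∀ᶠ z in 𝓝 x, u z < b := by
      have := hu x hxU b ((le_max_left _ _).trans_lt hb)
      rwa [hU.nhdsWithin_eq hxU] at this
    filter_upwards [hux, hgx' b ((le_max_right _ _).trans_lt hb), hU.mem_nhds hxU] with z h1 h2 h3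
    simpa [h3] using ⟨h1, h2⟩
  · intro b hb
    have key : ∀ z, c < g z → (if z ∈ U then max (u z) (g z) else (g z : EReal)) = g z := by
      intro z hz
      split_ifs with hzU
      · exact max_eq_right ((huc z hzU).trans (EReal.coe_le_coe_iff.2 hz.le))
      · rfl
    beta_reduce at hb ⊢
    rw [key x hc] at hb
    filter_upwards [hgx' b hb, hgx.eventually (lt_mem_nhds hc)] with z h1 h2
    rwa [key z h2]

open Classical in
-- The bound `g ≤ h` holds on all of `G`, so `u` needs separate treatment only where `g < c`.
-- Frontier points of that part lying in `G` satisfy `u ≤ c ≤ g ≤ h`; the others lie on the frontier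
-- of `G`. No local characterization of subharmonicity is needed.
theorem IsSubharmonicOn.glue {E : Type*} [NormedAddCommGroup E] [InnerProductSpace ℝ E]
    [FiniteDimensional ℝ E] {u : E → EReal} {g : E → ℝ} {U V : Set E} (hU : IsOpen U)
    (hV : IsOpen V) (hu : IsSubharmonicOn u U) (hg : IsSubharmonicOn (fun x => (g x : EReal)) V)
    (hgc : ContinuousOn g V) {c : ℝ} (huc : ∀ x ∈ U, u x ≤ c)
    (hsub : ∀ x ∈ V, g x ≤ c → x ∈ U) :
    IsSubharmonicOn (fun x => if x ∈ U then max (u x) (g x) else (g x : EReal)) V where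
  upperSemicontinuousOn :=
    upperSemicontinuousOn_glue hU hV hu.upperSemicontinuousOn hgc huc hsub
  lt_top x _ := by
    split_ifs with h
    · exact max_lt (hu.lt_top x h) (EReal.coe_lt_top _)
    · exact EReal.coe_lt_top _
  le_of_harmonic := by
    intro G h hG hGc hGV hhc hh hle
    have hgv : ∀ x, (g x : EReal) ≤ if x ∈ U then max (u x) (g x) else (g x : EReal) := by
      intro x
      split_ifs
      · exact le_max_right _ _
      · exact le_rfl
    have hgh : ∀ x ∈ G, (g x : EReal) ≤ h x :=
      hg.le_of_harmonic G h hG hGc hGV hhc hh fun x hx => (hgv x).trans (hle x hx)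
    set G' := G ∩ g ⁻¹' Iio c with hG'
    have hG'o : IsOpen G' := (hgc.mono (subset_closure.trans hGV)).isOpen_inter_preimage hG isOpen_Iio
    have hcl : closure G' ⊆ closure G := closure_mono inter_subset_left
    have hgle : ∀ x ∈ closure G', g x ≤ c := fun x hx =>
      ContinuousWithinAt.closure_le hx
        ((hgc x (hGV (hcl hx))).mono (inter_subset_left.trans (subset_closure.trans hGV)))
        continuousWithinAt_const fun y hy => hy.2.le
    have hclU : closure G' ⊆ U := fun x hx => hsub x (hGV (hcl hx)) (hgle x hx)
    have huG' : ∀ x ∈ G', u x ≤ h x := by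
      refine hu.le_of_harmonic G' h hG'o (hGc.of_isClosed_subset isClosed_closure hcl) hclU
        (hhc.mono hcl) (hh.mono inter_subset_left) fun x hx => ?_
      by_cases hxG : x ∈ G
      · have hcg : c ≤ g x := not_lt.1 fun hlt => hx.2 (hG'o.interior_eq.symm ▸ ⟨hxG, hlt⟩)
        exact (huc x (hclU hx.1)).trans ((EReal.coe_le_coe_iff.2 hcg).trans (hgh x hxG))
      · have := hle x ⟨hcl hx.1, fun hi => hxG (interior_subset hi)⟩
        rw [if_pos (hclU hx.1)] at this
        exact (le_max_left _ _).trans this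
    intro x hx
    split_ifs with hxU
    · refine max_le ?_ (hgh x hx)
      rcases lt_or_ge (g x) c with hc | hc
      · exact huG' x ⟨hx, hc⟩
      · exact (huc x hxU).trans ((EReal.coe_le_coe_iff.2 hc).trans (hgh x hx))
    · exact hgh x hx

open Classical in
theorem IsOPSH.glue {u : Octonion2 → EReal} {g : Octonion2 → ℝ} {U V : Set Octonion2}
    (hU : IsOpen U) (hV : IsOpen V) (hu : IsOPSH u U) (hg : IsOPSH (fun x => (g x : EReal)) V)
    (hgc : ContinuousOn g V) {c : ℝ} (huc : ∀ x ∈ U, u x ≤ c)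
    (hsub : ∀ x ∈ V, g x ≤ c → x ∈ U) :
    IsOPSH (fun x => if x ∈ U then max (u x) (g x) else (g x : EReal)) V where
  upperSemicontinuousOn :=
    upperSemicontinuousOn_glue hU hV hu.upperSemicontinuousOn hgc huc hsub
  lt_top x _ := by
    split_ifs with h
    · exact max_lt (hu.lt_top x h) (EReal.coe_lt_top _)
    · exact EReal.coe_lt_top _
  subharmonic_line L hL p := by
    have hp : Continuous fun t : L => p + (t : Octonion2) :=
      continuous_const.add continuous_subtype_val
    exact IsSubharmonicOn.glue (hU.preimage hp) (hV.preimage hp) (hu.subharmonic_line L hL p)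
      (hg.subharmonic_line L hL p) (hgc.comp hp.continuousOn fun t ht => ht)
      (fun t ht => huc _ ht) fun t ht => hsub _ ht

theorem EReal.continuous_add_coe (c : ℝ) : Continuous fun x : EReal => x + (c : EReal) :=
  continuous_iff_continuousAt.2 fun x =>
    ContinuousAt.comp (f := fun x : EReal => (x, (c : EReal))) (g := fun p : EReal × EReal => p.1 + p.2)
      (EReal.continuousAt_add (by simp) (by simp)) (by fun_prop)

theorem EReal.add_coe_neg_le_iff {x y : EReal} {c : ℝ} :
    x + ((-c : ℝ) : EReal) ≤ y ↔ x ≤ y + (c : EReal) := by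
  rw [EReal.coe_neg, ← sub_eq_add_neg]
  exact EReal.sub_le_iff_le_add (by simp) (by simp)

theorem UpperSemicontinuousOn.add_coe {X : Type*} [TopologicalSpace X] {u : X → EReal} {U : Set X}
    (hu : UpperSemicontinuousOn u U) (c : ℝ) :
    UpperSemicontinuousOn (fun x => u x + (c : EReal)) U :=
  (EReal.continuous_add_coe c).comp_upperSemicontinuousOn hu fun _ _ h => add_le_add h le_rfl

theorem IsSubharmonicOn.add_coe_neg {E : Type*} [NormedAddCommGroup E] [InnerProductSpace ℝ E]
    [FiniteDimensional ℝ E] {u : E → EReal} {U : Set E} (hu : IsSubharmonicOn u U) (c : ℝ) :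
    IsSubharmonicOn (fun x => u x + ((-c : ℝ) : EReal)) U where
  upperSemicontinuousOn := hu.upperSemicontinuousOn.add_coe _
  lt_top x hx := EReal.add_lt_top (hu.lt_top x hx).ne (EReal.coe_ne_top _)
  le_of_harmonic G h hG hGc hGU hhc hh hle x hx := by
    rw [EReal.add_coe_neg_le_iff, ← EReal.coe_add]
    refine hu.le_of_harmonic G (fun x => h x + c) hG hGc hGU (hhc.add continuousOn_const)
      (hh.add (harmonicOnNhd_const c)) (fun y hy => ?_) x hx
    rw [EReal.coe_add, ← EReal.add_coe_neg_le_iff]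
    exact hle y hy

theorem IsSubharmonicOn.const_mul {E : Type*} [NormedAddCommGroup E] [InnerProductSpace ℝ E]
    [FiniteDimensional ℝ E] {g : E → ℝ} {U : Set E} (hg : IsSubharmonicOn (fun x => (g x : EReal)) U)
    (hgc : ContinuousOn g U) {M : ℝ} (hM : 0 < M) :
    IsSubharmonicOn (fun x => ((M * g x : ℝ) : EReal)) U where
  upperSemicontinuousOn := (continuous_coe_real_ereal.comp_continuousOn
    (continuousOn_const.mul hgc)).upperSemicontinuousOn
  lt_top _ _ := EReal.coe_lt_top _
  le_of_harmonic G h hG hGc hGU hhc hh hle x hx := by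
    have key := hg.le_of_harmonic G (M⁻¹ • h) hG hGc hGU (hhc.const_smul _) hh.const_smul
      (fun y hy => ?_) x hx
    · rw [EReal.coe_le_coe_iff] at key ⊢
      rwa [Pi.smul_apply, smul_eq_mul, le_inv_mul_iff₀ hM] at key
    · have := hle y hy
      rw [EReal.coe_le_coe_iff] at this ⊢
      rwa [Pi.smul_apply, smul_eq_mul, le_inv_mul_iff₀ hM]

theorem IsOPSH.const_mul {g : Octonion2 → ℝ} {U : Set Octonion2}
    (hg : IsOPSH (fun x => (g x : EReal)) U) (hgc : ContinuousOn g U) {M : ℝ} (hM : 0 < M) :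
    IsOPSH (fun x => ((M * g x : ℝ) : EReal)) U where
  upperSemicontinuousOn := (continuous_coe_real_ereal.comp_continuousOn
    (continuousOn_const.mul hgc)).upperSemicontinuousOn
  lt_top _ _ := EReal.coe_lt_top _
  subharmonic_line L hL p :=
    (hg.subharmonic_line L hL p).const_mul
      (hgc.comp (continuous_const.add continuous_subtype_val).continuousOn fun _ ht => ht) hM

theorem IsOPSH.translate_add_coe_neg {u : Octonion2 → EReal} {Ω : Set Octonion2} (hu : IsOPSH u Ω)
    (y : Octonion2) (c : ℝ) :
    IsOPSH (fun x => u (x + y) + ((-c : ℝ) : EReal)) {x | x + y ∈ Ω} where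
  upperSemicontinuousOn :=
    (hu.upperSemicontinuousOn.comp (g := fun x => x + y) (t := {x | x + y ∈ Ω})
      (continuous_id.add continuous_const).continuousOn fun _ hx => hx).add_coe _
  lt_top x hx := EReal.add_lt_top (hu.lt_top _ hx).ne (EReal.coe_ne_top _)
  subharmonic_line L hL p := by
    have e : ∀ t : L, p + (t : Octonion2) + y = p + y + t := fun t => add_right_comm _ _ _
    simp only [mem_ofPred_eq, e]
    exact (hu.subharmonic_line L hL (p + y)).add_coe_neg c

end Gluing

/-! ### Continuity of the envelope in a hyperconvex domain. -/

section RelativeExtremal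

variable {K Ω : Set Octonion2}

theorem extremalEnvelope_nonpos {x : Octonion2} (hx : x ∈ Ω) : extremalEnvelope K Ω x ≤ 0 :=
  iSup₂_le fun _ hu => hu.2.1 x hx

theorem neg_one_le_extremalEnvelope (x : Octonion2) : -1 ≤ extremalEnvelope K Ω x :=
  le_iSup₂ (f := fun (u : Octonion2 → EReal) (_ : u ∈ extremalClass K Ω) => u x)
    (fun _ => ((-1 : ℝ) : EReal)) ⟨isOPSH_const _ _, fun _ _ => by norm_num, fun _ _ => le_rfl⟩

theorem extremalEnvelope_eq_neg_one {x : Octonion2} (hx : x ∈ K) : extremalEnvelope K Ω x = -1 :=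
  le_antisymm (iSup₂_le fun _ hu => hu.2.2 x hx) (neg_one_le_extremalEnvelope x)

/-- Gluing a translate of a competitor with a multiple of the exhaustion function produces another
competitor. -/
theorem extremalEnvelope_add_le (hΩ : IsOpen Ω) {g : Octonion2 → ℝ}
    (hg : IsOPSH (fun x => (g x : EReal)) Ω) (hgc : ContinuousOn g Ω) (hg0 : ∀ x ∈ Ω, g x ≤ 0)
    (hgK : ∀ x ∈ K, g x ≤ -1) {ε : ℝ} (hε : 0 ≤ ε) {y : Octonion2}
    (hyΩ : ∀ x ∈ Ω, g x ≤ -ε → x + y ∈ Ω)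
    (hyK : ∀ x ∈ K, extremalEnvelope K Ω (x + y) ≤ ((-1 + ε : ℝ) : EReal)) {x : Octonion2}
    (hxy : x + y ∈ Ω) :
    extremalEnvelope K Ω (x + y) ≤ extremalEnvelope K Ω x + (ε : EReal) := by
  classical
  refine iSup₂_le fun u hu => ?_
  have hle : ∀ z, u z ≤ extremalEnvelope K Ω z := fun z =>
    le_iSup₂ (f := fun (u : Octonion2 → EReal) (_ : u ∈ extremalClass K Ω) => u z) u hu
  have huc : ∀ z ∈ {z | z + y ∈ Ω}, u (z + y) + ((-ε : ℝ) : EReal) ≤ ((-ε : ℝ) : EReal) := by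
    intro z hz
    rw [EReal.add_coe_neg_le_iff, ← EReal.coe_add, neg_add_cancel]
    exact hu.2.1 _ hz
  -- The gluing level is `c = -ε`: the lowered translate never exceeds it, and `g` lies above it
  -- wherever the translate is undefined.
  have hv := IsOPSH.glue (U := {z | z + y ∈ Ω}) (hΩ.preimage (continuous_id.add continuous_const)) hΩ
    (hu.1.translate_add_coe_neg y ε) hg hgc huc hyΩ
  have hmem := le_iSup₂ (f := fun (u : Octonion2 → EReal) (_ : u ∈ extremalClass K Ω) => u x) _
    ⟨hv, fun z hz => ?_, fun z hz => ?_⟩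
  · rw [← EReal.add_coe_neg_le_iff]
    refine le_trans ?_ hmem
    rw [if_pos (show x ∈ {z | z + y ∈ Ω} from hxy)]
    exact le_max_left _ _
  · split_ifs with hzU
    · refine max_le ((huc z hzU).trans ?_) (by exact_mod_cast hg0 z hz)
      exact_mod_cast neg_nonpos.2 hε
    · exact_mod_cast hg0 z hz
  · have hgz : (g z : EReal) ≤ ((-1 : ℝ) : EReal) := EReal.coe_le_coe_iff.2 (hgK z hz)
    split_ifs with hzU
    · refine max_le ?_ hgz
      rw [EReal.add_coe_neg_le_iff]
      refine (hle _).trans ((hyK z hz).trans ?_)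
      rw [EReal.coe_add]
      rfl
    · exact hgz

/-- A slightly larger concentric ball still fits in `Ω`, and the explicit function for this pair is
a continuous majorant equal to `-1` on the smaller ball, boundary included. This is where `K` being
a union of balls matters. -/
theorem eventually_extremalEnvelope_le (hΩ : IsOpen Ω) (hKΩ : K ⊆ Ω) {a : Octonion2} {r : ℝ}
    (hr : 0 < r) (hK : closedBall a r ⊆ K) {x : Octonion2} (hx : x ∈ closedBall a r) {ε : ℝ}
    (hε : 0 < ε) : ∀ᶠ z in 𝓝 x, extremalEnvelope K Ω z ≤ ((-1 + ε : ℝ) : EReal) := by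
  obtain ⟨δ, hδ, hthick⟩ :=
    (isCompact_closedBall a r).exists_thickening_subset_open hΩ (hK.trans hKΩ)
  rw [thickening_closedBall hδ hr.le] at hthick
  have hR : r < δ + r := by linarith
  have hx1 : concentricExtremal a r (δ + r) x < -1 + ε := by
    rw [concentricExtremal_of_norm_le hr hR (by rwa [← dist_eq_norm])]
    linarith
  filter_upwards [isOpen_ball.mem_nhds (closedBall_subset_ball hR hx),
    (continuous_concentricExtremal hr hR).continuousAt.eventually (gt_mem_nhds hx1)] with z hz hz1
  exact (extremalEnvelope_le_concentricExtremal hr hR hK hthick hz).trans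
    (EReal.coe_le_coe_iff.2 hz1.le)

theorem exists_pos_forall_mul_le_neg_one (hK : IsCompact K) {ϱ : Octonion2 → ℝ}
    (hϱ : ContinuousOn ϱ K) (hneg : ∀ x ∈ K, ϱ x < 0) : ∃ M > 0, ∀ x ∈ K, M * ϱ x ≤ -1 := by
  rcases K.eq_empty_or_nonempty with rfl | hne
  · exact ⟨1, one_pos, by simp⟩
  obtain ⟨x₀, hx₀, hmax⟩ := hK.exists_isMaxOn hne hϱ
  have h0 : 0 < -ϱ x₀ := neg_pos.2 (hneg x₀ hx₀)
  refine ⟨(-ϱ x₀)⁻¹, inv_pos.2 h0, fun x hx => ?_⟩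
  rw [inv_mul_le_iff₀ h0]
  have : ϱ x ≤ ϱ x₀ := hmax hx
  linarith

/-- The envelope of a compact union of closed balls in a hyperconvex domain is uniformly
continuous. -/
theorem exists_extremalEnvelope_le_add (hΩ : IsOctonionicHyperconvex Ω) (hK : IsCompact K)
    (hKΩ : K ⊆ Ω) {ι : Type*} {a : ι → Octonion2} {r : ι → ℝ} (hr : ∀ i, 0 < r i)
    (hKe : K = ⋃ i, closedBall (a i) (r i)) {ε : ℝ} (hε : 0 < ε) :
    ∃ δ > 0, ∀ x ∈ Ω, ∀ z ∈ Ω, dist z x < δ →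
      extremalEnvelope K Ω z ≤ extremalEnvelope K Ω x + (ε : EReal) := by
  obtain ⟨hΩo, -, ϱ, hϱc, hϱ, hϱneg, -, hϱcomp⟩ := hΩ
  obtain ⟨M, hM, hMK⟩ := exists_pos_forall_mul_le_neg_one hK (hϱc.mono hKΩ)
    fun x hx => hϱneg x (hKΩ hx)
  -- Half of `-ε/M`, so that the strict sublevel set contains the closed condition `Mϱ ≤ -ε`.
  have hc : -(ε / M) / 2 < 0 := by
    have : 0 < ε / M := by positivity
    linarith
  obtain ⟨hC, hCΩ⟩ := hϱcomp _ hc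
  obtain ⟨δ₁, hδ₁, hthick₁⟩ := hC.exists_thickening_subset_open hΩo hCΩ
  have hKW : K ⊆ interior {x | extremalEnvelope K Ω x ≤ ((-1 + ε : ℝ) : EReal)} := by
    intro x hx
    rw [mem_interior_iff_mem_nhds]
    obtain ⟨i, hi⟩ := mem_iUnion.1 (hKe ▸ hx)
    exact eventually_extremalEnvelope_le hΩo hKΩ (hr i)
      (hKe ▸ subset_iUnion (fun i => closedBall (a i) (r i)) i) hi hε
  obtain ⟨δ₂, hδ₂, hthick₂⟩ := hK.exists_thickening_subset_open isOpen_interior hKW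
  refine ⟨min δ₁ δ₂, lt_min hδ₁ hδ₂, fun x hx z hz hzx => ?_⟩
  have hW : ∀ {p}, p ∈ interior {x | extremalEnvelope K Ω x ≤ ((-1 + ε : ℝ) : EReal)} →
      extremalEnvelope K Ω p ≤ ((-1 + ε : ℝ) : EReal) := by
    intro p hp
    have := interior_subset hp
    exact this
  have hdist : ∀ p : Octonion2, dist (p + (z - x)) p = dist z x := fun p => by
    rw [dist_eq_norm, add_sub_cancel_left, dist_eq_norm]
  rw [← add_sub_cancel x z] at hz ⊢
  refine extremalEnvelope_add_le hΩo (hϱ.const_mul hϱc hM) (continuousOn_const.mul hϱc)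
    (fun p hp => mul_nonpos_of_nonneg_of_nonpos hM.le (hϱneg p hp).le) hMK hε.le
    (fun p hp hpε => hthick₁ (mem_thickening_iff.2 ⟨p, subset_closure ⟨hp, ?_⟩, ?_⟩))
    (fun p hp => hW (hthick₂ (mem_thickening_iff.2 ⟨p, hp, ?_⟩))) hz
  · have : ϱ p ≤ -(ε / M) := by
      rw [← neg_div, le_div_iff₀ hM, mul_comm]
      exact hpε
    linarith
  · rw [hdist]
    exact hzx.trans_le (min_le_left _ _)
  · rw [hdist]
    exact hzx.trans_le (min_le_right _ _)

theorem exists_continuousOn_extremalEnvelope_eq (hΩ : IsOctonionicHyperconvex Ω)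
    (hK : IsCompact K) (hKΩ : K ⊆ Ω) {ι : Type*} {a : ι → Octonion2} {r : ι → ℝ}
    (hr : ∀ i, 0 < r i) (hKe : K = ⋃ i, closedBall (a i) (r i)) :
    ∃ g : Octonion2 → ℝ, ContinuousOn g Ω ∧ ∀ x ∈ Ω, extremalEnvelope K Ω x = (g x : EReal) := by
  have hcoe : ∀ x ∈ Ω, extremalEnvelope K Ω x = ((extremalEnvelope K Ω x).toReal : EReal) := by
    intro x hx
    refine (EReal.coe_toReal ?_ ?_).symm
    · exact ((extremalEnvelope_nonpos hx).trans_lt EReal.zero_lt_top).ne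
    · exact ((EReal.bot_lt_coe (-1)).trans_le (neg_one_le_extremalEnvelope x)).ne'
  refine ⟨fun x => (extremalEnvelope K Ω x).toReal, ?_, hcoe⟩
  rw [Metric.continuousOn_iff]
  intro x hx ε hε
  obtain ⟨δ, hδ, h⟩ := exists_extremalEnvelope_le_add hΩ hK hKΩ hr hKe (half_pos hε)
  refine ⟨δ, hδ, fun z hz hzx => ?_⟩
  have h1 := h x hx z hz hzx
  have h2 := h z hz x hx (by rwa [dist_comm])
  rw [hcoe x hx, hcoe z hz, ← EReal.coe_add, EReal.coe_le_coe_iff] at h1 h2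
  rw [Real.dist_eq, abs_lt]
  constructor <;> linarith

end RelativeExtremal

theorem proposition7p2 :
    (∀ (Ω : Set Octonion2), IsOctonionicHyperconvex Ω →
      ∀ (K : Set Octonion2), IsCompact K → K ⊆ Ω →
      ∀ (ι : Type*) (a : ι → Octonion2) (r : ι → ℝ), (∀ i, 0 < r i) →
        K = ⋃ i, closedBall (a i) (r i) →
        (∃ g : Octonion2 → ℝ, ContinuousOn g Ω ∧
          ∀ x ∈ Ω, relativeExtremal K Ω x = (g x : EReal)) ∧
        ∀ x ∈ K, relativeExtremal K Ω x = -1) ∧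
    (∀ (a : Octonion2) (r R : ℝ), 0 < r → r < R → ∀ x ∈ ball a R,
      extremalEnvelope (closedBall a r) (ball a R) x = (concentricExtremal a r R x : EReal) ∧
      relativeExtremal (closedBall a r) (ball a R) x = (concentricExtremal a r R x : EReal)) := by
  refine ⟨fun Ω hΩ K hK hKΩ ι a r hr hKe => ?_, fun a r R hr hR x hx => ?_⟩
  · obtain ⟨g, hg, hge⟩ := exists_continuousOn_extremalEnvelope_eq hΩ hK hKΩ hr hKe
    refine ⟨⟨g, hg, fun x hx => relativeExtremal_eq_of_continuousOn hg hge hx⟩, fun x hx => ?_⟩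
    rw [relativeExtremal_eq_of_continuousOn hg hge (hKΩ hx), ← hge x (hKΩ hx),
      extremalEnvelope_eq_neg_one hx]
  · exact ⟨extremalEnvelope_closedBall_ball hr hR hx,
      relativeExtremal_eq_of_continuousOn (continuous_concentricExtremal hr hR).continuousOn
        (fun _ hy => extremalEnvelope_closedBall_ball hr hR hy) hx⟩
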